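/- A dcpo is a partially ordered set in which every (nonempty) directed subset has a supremum, and $\mathbf{DCPO}$ is the category of dcpos and Scott-continuous maps (those preserving suprema of directed subsets), with its cartesian products. For a dcpo $D$ with Scott topology $\sigma D$, let $\mathcal V D$ be the dcpo of subprobability valuations on $D$, i.e. Scott-continuous maps $\nu\colon\sigma D\to[0,1]$ with $\nu(\emptyset)=0$ and $\nu(U)+\nu(V)=\nu(U\cup V)+\nu(U\cap V)$, ordered pointwise. For Scott-continuous $f\colon D\to[0,1]$ put $\int_{x\in D} f(x)\,d\nu=\int_0^1\nu(f^{-1}((t,1]))\,dt$. Let $\mathcal M D$ be the smallest sub-dcpo of $\mathcal V D$ (subset closed under suprema of directed subsets) that contains all simple valuations $\sum_{i=1}^n r_i\delta_{x_i}$ ($n\ge 0$, $x_i\in D$, $r_i>0$, $\sum_i r_i\le 1$), where $\delta_x(U)=1$ if $x\in U$ and $\delta_x(U)=0$ otherwise. Theorem. $\mathcal M$ is a commutative strong monad on $\mathbf{DCPO}$, with - unit $D\to\mathcal M D$, $x\mapsto\delta_x$; - Kleisli extension $f^{\ddagger}\colon\mathcal M D\to\mathcal M E$ of a Scott-continuous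 map $f\colon D\to\mathcal M E$ given by $f^{\ddagger}(\nu)(U)=\int_{x\in D} f(x)(U)\,d\nu$ for $U\in\sigma E$; - strength $\tau_{D,E}\colon D\times\mathcal M E\to\mathcal M(D\times E)$ given by $\tau_{D,E}(x,\nu)(U)=\int_{y\in E}\chi_U(x,y)\,d\nu$ for $U\in\sigma(D\times E)$. (In particular these formulas define elements of $\mathcal M E$ and $\mathcal M(D\times E)$ and Scott-continuous maps.) Moreover, for all dcpos $D$ and $E$, all $\nu\in\mathcal M D$ and $\xi\in\mathcal M E$, and all $U\in\sigma(D\times E)$, $$\int_{x\in D}\int_{y\in E}\chi_U(x,y)\,d\xi\,d\nu=\int_{y\in E}\int_{x\in D}\chi_U(x,y)\,d\nu\,d\xi .$$ -/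

import Mathlib

open CategoryTheory MonoidalCategory CartesianMonoidalCategory TopologicalSpace Topology

/-! ### Dcpos and Scott-continuous maps -/

/-- A partial order is a dcpo if every nonempty directed subset has a supremum. -/
class IsDcpo (D : Type*) [PartialOrder D] : Prop where
  exists_isLUB : ∀ s : Set D, s.Nonempty → DirectedOn (· ≤ ·) s → ∃ a, IsLUB s a

/-- Scott-continuous maps. -/
structure ScottHom (D E : Type*) [PartialOrder D] [PartialOrder E] where
  toFun : D → E
  scottContinuous : ScottContinuous toFun

namespace ScottHom

variable {D E F : Type*} [PartialOrder D] [PartialOrder E] [PartialOrder F]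

instance : FunLike (ScottHom D E) D E where
  coe := toFun
  coe_injective f g h := by cases f; cases g; congr

@[ext] theorem ext {f g : ScottHom D E} (h : ∀ x, f x = g x) : f = g := DFunLike.ext _ _ h

protected def id (D : Type*) [PartialOrder D] : ScottHom D D := ⟨fun x => x, ScottContinuous.id⟩

def comp (g : ScottHom E F) (f : ScottHom D E) : ScottHom D F :=
  ⟨fun x => g (f x), ScottContinuous.comp f.scottContinuous g.scottContinuous⟩

/-- A Scott-continuous map, as a continuous map for the Scott topologies. -/
def toContinuousMap (f : ScottHom D E) : C(WithScott D, WithScott E) where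
  toFun x := WithScott.toScott (f (WithScott.ofScott x))
  continuous_toFun :=
    (IsScott.scottContinuousOn_iff_continuous (α := WithScott D) (β := WithScott E)
      (D := Set.univ) (fun _ _ _ => Set.mem_univ _)).1
      (scottContinuousOn_univ.2 f.scottContinuous)

end ScottHom

/-! ### The category of dcpos -/

universe u

/-- The objects of the category of dcpos and Scott-continuous maps. -/
structure DCPO : Type (u + 1) where
  carrier : Type u
  [order : PartialOrder carrier]
  [dcpo : IsDcpo carrier]

namespace DCPO

instance : CoeSort DCPO.{u} (Type u) := ⟨carrier⟩

instance (D : DCPO.{u}) : PartialOrder D := D.order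

instance (D : DCPO.{u}) : IsDcpo D := D.dcpo

instance : Category DCPO.{u} where
  Hom D E := ScottHom D E
  id D := ScottHom.id D
  comp f g := g.comp f

instance : ConcreteCategory DCPO.{u} (fun D E => ScottHom D E) where
  hom f := f
  ofHom f := f

theorem hom_ext' {D E : DCPO.{u}} {f g : D ⟶ E} (h : ∀ x : D, f x = g x) : f = g :=
  ScottHom.ext h

end DCPO

instance (D E : Type*) [PartialOrder D] [PartialOrder E] [IsDcpo D] [IsDcpo E] :
    IsDcpo (D × E) where
  exists_isLUB s hs hd := by
    obtain ⟨a, ha⟩ := IsDcpo.exists_isLUB (Prod.fst '' s) (hs.image _)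
      (hd.fst)
    obtain ⟨b, hb⟩ := IsDcpo.exists_isLUB (Prod.snd '' s) (hs.image _)
      (hd.snd)
    exact ⟨(a, b), isLUB_prod.2 ⟨ha, hb⟩⟩

instance : IsDcpo PUnit where
  exists_isLUB _ _ _ := ⟨PUnit.unit, fun _ _ => le_rfl, fun _ _ => le_rfl⟩

namespace DCPO

/-- The product of two dcpos, with the componentwise order. -/
def prod (D E : DCPO.{u}) : DCPO.{u} := ⟨D × E⟩

/-- The one-point dcpo. -/
def one : DCPO.{u} := ⟨PUnit⟩

/-- The cartesian product structure on the category of dcpos. -/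
instance : CartesianMonoidalCategory DCPO.{u} :=
  .ofChosenFiniteProducts
    ⟨Limits.asEmptyCone one, Limits.IsTerminal.ofUniqueHom
      (fun _ => (⟨fun _ => PUnit.unit, ScottContinuous.const _⟩ : ScottHom _ PUnit))
      (fun _ _ => hom_ext' fun _ => rfl)⟩
    fun D E =>
      ⟨Limits.BinaryFan.mk (P := prod D E)
        (⟨Prod.fst, ScottContinuous.fst⟩ : ScottHom (D × E) D)
        (⟨Prod.snd, ScottContinuous.snd⟩ : ScottHom (D × E) E),
       Limits.BinaryFan.IsLimit.mk _
        (fun {T} f g => (⟨fun x => (f x, g x),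
          ScottContinuous.prodMk (ScottHom.scottContinuous f) (ScottHom.scottContinuous g)⟩ :
            ScottHom T (D × E)))
        (fun _ _ => rfl) (fun _ _ => rfl)
        (fun _ _ m h₁ h₂ => by subst h₁; subst h₂; rfl)⟩

instance : BraidedCategory DCPO.{u} := .ofCartesianMonoidalCategory

end DCPO

/-! ### Subprobability valuations -/

/-- A subprobability valuation on a space: a Scott-continuous, strict and modular map from the
lattice of open sets to the unit interval. -/
structure SubprobValuation (X : Type*) [TopologicalSpace X] where
  toFun : Opens X → unitInterval
  scottContinuous : ScottContinuous toFun
  strict : toFun ⊥ = 0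
  modular : ∀ U V : Opens X,
    (toFun U : ℝ) + toFun V = toFun (U ⊔ V) + toFun (U ⊓ V)

namespace SubprobValuation

variable {X : Type*} [TopologicalSpace X]

instance : FunLike (SubprobValuation X) (Opens X) unitInterval where
  coe := toFun
  coe_injective f g h := by cases f; cases g; congr

/-- The stochastic order. -/
instance : PartialOrder (SubprobValuation X) where
  le ν ξ := ∀ U, ν U ≤ ξ U
  le_refl _ _ := le_rfl
  le_trans _ _ _ h₁ h₂ U := (h₁ U).trans (h₂ U)
  le_antisymm _ _ h₁ h₂ := DFunLike.ext _ _ fun U => le_antisymm (h₁ U) (h₂ U)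

/-- The directed supremum of valuations, computed pointwise. -/
noncomputable def dirSup (s : Set (SubprobValuation X)) (hs : s.Nonempty)
    (hd : DirectedOn (· ≤ ·) s) : SubprobValuation X where
  toFun U := ⨆ ν : s, (ν : SubprobValuation X) U
  scottContinuous := by
    intro d _ _ V hV
    refine ⟨?_, fun b hb => ?_⟩
    · rintro _ ⟨U, hU, rfl⟩
      exact iSup_mono fun ν => ν.1.scottContinuous.monotone (hV.1 hU)
    · refine iSup_le fun ν => (ν.1.scottContinuous ‹_› ‹_› hV).2 ?_
      rintro _ ⟨U, hU, rfl⟩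
      exact (le_iSup (fun ν : s => (ν : SubprobValuation X) U) ν).trans (hb ⟨U, hU, rfl⟩)
  strict := by
    have : ∀ ν : s, (ν : SubprobValuation X) ⊥ = 0 := fun ν => ν.1.strict
    have := hs.to_subtype
    simp [*]
  modular U V := by
    have := hs.to_subtype
    have : IsDirectedOrder s := ⟨fun a b => by
      obtain ⟨c, hc, h₁, h₂⟩ := hd a a.2 b b.2
      exact ⟨⟨c, hc⟩, h₁, h₂⟩⟩
    have key : ∀ W : Opens X, Filter.Tendsto (fun ν : s => ((ν : SubprobValuation X) W : ℝ))
        Filter.atTop (𝓝 ((⨆ ν : s, (ν : SubprobValuation X) W : unitInterval) : ℝ)) := fun W =>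
      (continuous_subtype_val.tendsto _).comp
        (tendsto_atTop_isLUB (fun a b h => h W) isLUB_iSup)
    refine tendsto_nhds_unique ((key U).add (key V)) (((key (U ⊔ V)).add (key (U ⊓ V))).congr ?_)
    exact fun ν => (ν.1.modular U V).symm

theorem isLUB_dirSup (s : Set (SubprobValuation X)) (hs : s.Nonempty)
    (hd : DirectedOn (· ≤ ·) s) : IsLUB s (dirSup s hs hd) :=
  ⟨fun ν hν U => le_iSup (fun ν : s => (ν : SubprobValuation X) U) ⟨ν, hν⟩,
   fun _ hb U => iSup_le fun ν => hb ν.2 U⟩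

instance : IsDcpo (SubprobValuation X) where
  exists_isLUB s hs hd := ⟨_, isLUB_dirSup s hs hd⟩

/-- Evaluation of valuations at an open set is Scott-continuous. -/
def eval (U : Opens X) : ScottHom (SubprobValuation X) unitInterval where
  toFun ν := ν U
  scottContinuous := by
    intro s hs hd ν hν
    rw [hν.unique (isLUB_dirSup s hs hd)]
    refine ⟨?_, fun b hb => iSup_le fun ν => hb ⟨ν, ν.2, rfl⟩⟩
    rintro _ ⟨ν, h, rfl⟩
    exact (isLUB_dirSup s hs hd).1 h U

open Classical in
/-- The Dirac valuation at a point. -/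
noncomputable def dirac (x : X) : SubprobValuation X where
  toFun U := if x ∈ U then 1 else 0
  scottContinuous := by
    intro d hd₀ hd V hV
    have hVU : V = sSup d := hV.unique (isLUB_sSup d)
    refine ⟨?_, fun b hb => ?_⟩
    · rintro _ ⟨U, hU, rfl⟩
      have : x ∈ U → x ∈ V := fun h => hV.1 hU h
      by_cases h : x ∈ U
      · simp [h, this h]
      · simp [h]
    · by_cases h : x ∈ V
      · rw [hVU, Opens.mem_sSup] at h
        obtain ⟨U, hU, hx⟩ := h
        have := hb ⟨U, hU, rfl⟩
        simp only [hx, if_true] at this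
        exact le_trans unitInterval.le_one' this
      · simp [h]
  strict := by simp
  modular U V := by
    by_cases h₁ : x ∈ U <;> by_cases h₂ : x ∈ V <;> simp [h₁, h₂]

/-- The simple valuations, that is, the finite sums of positive multiples of Dirac valuations,
with total mass at most one (the empty sum is the zero valuation). -/
def simple (X : Type*) [TopologicalSpace X] : Set (SubprobValuation X) :=
  {ν | ∃ (n : ℕ) (r : Fin n → ℝ) (x : Fin n → X), (∀ i, 0 < r i) ∧ ∑ i, r i ≤ 1 ∧
    ∀ U, (ν U : ℝ) = ∑ i, r i * (dirac (x i) U : ℝ)}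

/-- The intersection of all sub-dcpos of the dcpo of valuations that contain the simple
valuations. -/
def dClosureSimple (X : Type*) [TopologicalSpace X] : Set (SubprobValuation X) :=
  ⋂₀ {B | DirSupClosed B ∧ simple X ⊆ B}

theorem dirSupClosed_dClosureSimple : DirSupClosed (dClosureSimple X) := by
  intro d hd h₀ h₁ a ha B hB
  exact hB.1 (fun x hx => hd hx B hB) h₀ h₁ ha

instance : IsDcpo (dClosureSimple X) where
  exists_isLUB s hs hd := by
    have hd' : DirectedOn (· ≤ ·) (Subtype.val '' s) := by
      rintro _ ⟨a, ha, rfl⟩ _ ⟨b, hb, rfl⟩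
      obtain ⟨c, hc, h⟩ := hd a ha b hb
      exact ⟨c, ⟨c, hc, rfl⟩, h⟩
    obtain ⟨a, ha⟩ := IsDcpo.exists_isLUB _ (hs.image Subtype.val) hd'
    refine ⟨⟨a, dirSupClosed_dClosureSimple ?_ (hs.image _) hd' ha⟩,
      fun b hb => ha.1 ⟨b, hb, rfl⟩, fun b hb => ha.2 ?_⟩
    · rintro _ ⟨b, -, rfl⟩
      exact b.2
    · rintro _ ⟨c, hc, rfl⟩
      exact hb hc

/-- The inclusion of the d-closure of the simple valuations into all valuations. -/
def inclusion (X : Type*) [TopologicalSpace X] :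
    ScottHom (dClosureSimple X) (SubprobValuation X) where
  toFun := Subtype.val
  scottContinuous := by
    intro s hs hd a ha
    have hd' : DirectedOn (· ≤ ·) (Subtype.val '' s) := by
      rintro _ ⟨a, ha, rfl⟩ _ ⟨b, hb, rfl⟩
      obtain ⟨c, hc, h⟩ := hd a ha b hb
      exact ⟨c, ⟨c, hc, rfl⟩, h⟩
    obtain ⟨b, hb⟩ := IsDcpo.exists_isLUB _ (hs.image Subtype.val) hd'
    have hbm : b ∈ dClosureSimple X := dirSupClosed_dClosureSimple
      (by rintro _ ⟨c, -, rfl⟩; exact c.2) (hs.image _) hd' hb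
    have hab : (a : SubprobValuation X) = b := le_antisymm
      (ha.2 (show (⟨b, hbm⟩ : dClosureSimple X) ∈ upperBounds s from
        fun c hc => hb.1 ⟨c, hc, rfl⟩))
      (hb.2 (by rintro _ ⟨c, hc, rfl⟩; exact ha.1 hc))
    rw [hab]
    exact hb

/-! ### Integration -/

/-- The open set on which a continuous map to the unit interval (with its Scott topology)
exceeds `t`. -/
def superlevel (f : C(X, WithScott unitInterval)) (t : ℝ) : Opens X where
  carrier := {x | t < (WithScott.ofScott (f x) : unitInterval).1}
  is_open' := by
    have h : IsOpen {r : WithScott unitInterval | t < (WithScott.ofScott r : unitInterval).1} := by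
      rw [IsScott.isOpen_iff_isUpperSet_and_dirSupInaccOn (D := Set.univ)]
      refine ⟨fun a b hab (ha : t < (WithScott.ofScott a : unitInterval).1) =>
        (show t < (WithScott.ofScott b : unitInterval).1 from lt_of_lt_of_le ha hab), ?_⟩
      intro d _ hd₀ _ a ha (hta : t < (WithScott.ofScott a : unitInterval).1)
      by_contra hne
      have hle : ∀ b ∈ d, (WithScott.ofScott b : unitInterval).1 ≤ t := fun b hb =>
        not_lt.1 fun hlt => hne ⟨b, hb, hlt⟩
      obtain ⟨b, hb⟩ := hd₀
      have ht : t ∈ unitInterval :=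
        ⟨(WithScott.ofScott b : unitInterval).2.1.trans (hle b hb),
          hta.le.trans (WithScott.ofScott a : unitInterval).2.2⟩
      have : a ≤ WithScott.toScott (⟨t, ht⟩ : unitInterval) := ha.2 fun c hc => hle c hc
      exact absurd hta (not_lt.2 this)
    exact h.preimage f.continuous

/-- The integral of a continuous map `f` to the unit interval against a valuation `ν`, by the
Choquet formula: the integral over `t` from `0` to `1` of `ν {x | t < f x}`. -/
noncomputable def integral (ν : SubprobValuation X) (f : C(X, WithScott unitInterval)) :
    unitInterval :=
  ⟨∫ t in (0 : ℝ)..1, (ν (superlevel f t) : ℝ), by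
    have hanti : Antitone fun t => (ν (superlevel f t) : ℝ) := fun s t hst =>
      ν.scottContinuous.monotone fun x hx => lt_of_le_of_lt hst hx
    have hint := hanti.intervalIntegrable (μ := MeasureTheory.volume) (a := (0 : ℝ)) (b := 1)
    constructor
    · exact intervalIntegral.integral_nonneg zero_le_one fun t _ => (ν _).2.1
    · calc ∫ t in (0 : ℝ)..1, (ν (superlevel f t) : ℝ) ≤ ∫ _ in (0 : ℝ)..1, (1 : ℝ) :=
            intervalIntegral.integral_mono_on zero_le_one hint (by simp) fun t _ => (ν _).2.2
        _ = 1 := by simp⟩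

end SubprobValuation

namespace DCPO

/-- The dcpo of all subprobability valuations on a dcpo with its Scott topology. -/
def V (D : DCPO.{u}) : DCPO.{u} := ⟨SubprobValuation (WithScott D)⟩

/-- The smallest sub-dcpo of `V D` that contains the simple valuations. -/
def M (D : DCPO.{u}) : DCPO.{u} := ⟨SubprobValuation.dClosureSimple (WithScott D)⟩

/-- The inclusion of `M D` into `V D`. -/
def incl (D : DCPO.{u}) : M D ⟶ V D := SubprobValuation.inclusion (WithScott D)

/-- The integral of a Scott-continuous map to the unit interval against a valuation. -/
noncomputable def integral {D : DCPO.{u}} (ν : V D) (f : ScottHom D unitInterval) : unitInterval :=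
  SubprobValuation.integral (X := WithScott D) ν f.toContinuousMap

/-- The value at `U` of the Kleisli extension of `f` at `ν`, for the monad of all valuations:
the integral of `x ↦ f x U` against `ν`. -/
noncomputable def kleisliExt {D E : DCPO.{u}} (f : D ⟶ V E) (ν : V D)
    (U : Opens (WithScott E)) : unitInterval :=
  integral ν ((SubprobValuation.eval U).comp f)

open Classical in
/-- The characteristic function of a Scott-open set. -/
noncomputable def indicator {D : DCPO.{u}} (U : Opens (WithScott D)) : ScottHom D unitInterval where
  toFun x := if WithScott.toScott x ∈ U then 1 else 0
  scottContinuous := by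
    have hU := (IsScott.isOpen_iff_isUpperSet_and_dirSupInaccOn (D := Set.univ)).1 U.isOpen
    intro d h₀ hd a ha
    refine ⟨?_, fun b hb => ?_⟩
    · rintro _ ⟨x, hx, rfl⟩
      have : WithScott.toScott x ∈ U → WithScott.toScott a ∈ U := fun h => hU.1 (ha.1 hx) h
      by_cases h : WithScott.toScott x ∈ U
      · simp [h, this h]
      · simp [h]
    · by_cases h : WithScott.toScott a ∈ U
      · obtain ⟨x, hx, hxU⟩ := hU.2 (Set.mem_univ _) h₀ hd ha h
        exact (if_pos h).le.trans ((if_pos hxU).ge.trans (hb ⟨x, hx, rfl⟩))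
      · simp [h]

/-- The map `y ↦ (x, y)`. -/
def pairLeft {D : DCPO.{u}} (E : DCPO.{u}) (x : D) : E ⟶ D ⊗ E :=
  (⟨fun y => (x, y), ScottContinuous.prodMk (ScottContinuous.const x) ScottContinuous.id⟩ :
    ScottHom E (D × E))

/-- The map `x ↦ (x, y)`. -/
def pairRight (D : DCPO.{u}) {E : DCPO.{u}} (y : E) : D ⟶ D ⊗ E :=
  (⟨fun x => (x, y), ScottContinuous.prodMk ScottContinuous.id (ScottContinuous.const y)⟩ :
    ScottHom D (D × E))

/-- The value at `U` of the strength of the monad of all valuations at `(x, ν)`: the integral of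
`y ↦ χ_U (x, y)` against `ν`. -/
noncomputable def strengthVal {D E : DCPO.{u}} (x : D) (ν : V E)
    (U : Opens (WithScott (D ⊗ E : DCPO.{u}))) : unitInterval :=
  integral ν ((indicator U).comp (pairLeft E x))

/-- Integrating a characteristic function gives the measure of the set. -/
theorem integral_indicator_comp {D E : DCPO.{u}} (ν : V D) (U : Opens (WithScott E))
    (g : D ⟶ E) : integral ν ((indicator U).comp g) =
      (show SubprobValuation (WithScott D) from ν) (U.comap (ScottHom.toContinuousMap g)) := by
  set W : Opens (WithScott D) := U.comap (ScottHom.toContinuousMap g)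
  have hval : ∀ x : D, (indicator U).comp g x = 1 ∧ WithScott.toScott x ∈ W ∨
      (indicator U).comp g x = 0 ∧ WithScott.toScott x ∉ W := by
    intro x
    by_cases h : WithScott.toScott x ∈ W
    · exact Or.inl ⟨if_pos h, h⟩
    · exact Or.inr ⟨if_neg h, h⟩
  apply Subtype.ext
  have : ∀ t ∈ Set.Ioo (0 : ℝ) 1,
      SubprobValuation.superlevel ((indicator U).comp g).toContinuousMap t = W := by
    intro t ht
    ext x
    change t < (((indicator U).comp g (WithScott.ofScott x) : unitInterval) : ℝ) ↔ x ∈ W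
    rcases hval (WithScott.ofScott x) with ⟨h, h'⟩ | ⟨h, h'⟩
    · rw [h]; exact ⟨fun _ => h', fun _ => ht.2⟩
    · rw [h]; exact ⟨fun h => absurd h (not_lt.2 ht.1.le), fun h => absurd h h'⟩
  change ∫ t in (0 : ℝ)..1, _ = _
  rw [intervalIntegral.integral_of_le zero_le_one, MeasureTheory.integral_Ioc_eq_integral_Ioo,
    MeasureTheory.setIntegral_congr_fun measurableSet_Ioo
      (g := fun _ => (((show SubprobValuation (WithScott D) from ν) W : unitInterval) : ℝ))
      (fun t ht => by simp only [this t ht])]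
  simp

/-- Sections of Scott-open sets depend Scott-continuously on the parameter. -/
theorem scottContinuous_section {D E F : DCPO.{u}} (ν : V E) (U : Opens (WithScott F))
    (g : D → (E ⟶ F)) (hg : ∀ y : E, ScottContinuous fun x => g x y) :
    ScottContinuous fun x => integral ν ((indicator U).comp (g x)) := by
  have hU := (IsScott.isOpen_iff_isUpperSet_and_dirSupInaccOn (D := Set.univ)).1 U.isOpen
  simp only [integral_indicator_comp]
  refine ScottContinuous.comp
    (f := fun x => (U.comap (ScottHom.toContinuousMap (g x)) : Opens (WithScott E)))
    ?_ (SubprobValuation.scottContinuous ν)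
  intro d h₀ hd a ha
  refine ⟨?_, fun W hW y hy => ?_⟩
  · rintro _ ⟨x, hx, rfl⟩ y hy
    exact hU.1 ((hg (WithScott.ofScott y)).monotone (ha.1 hx)) hy
  · obtain ⟨_, ⟨x, hx, rfl⟩, hz⟩ := hU.2 (Set.mem_univ _)
      (h₀.image fun x => g x (WithScott.ofScott y))
      (hd.mono_comp (hg _).monotone) (hg (WithScott.ofScott y) h₀ hd ha) hy
    exact hW ⟨x, hx, rfl⟩ hz

/-- The map `x ↦ ∫ χ_U (x, y) dξ(y)`. -/
noncomputable def integralRight {D E : DCPO.{u}} (ξ : V E)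
    (U : Opens (WithScott (D ⊗ E : DCPO.{u}))) : ScottHom D unitInterval where
  toFun x := integral ξ ((indicator U).comp (pairLeft E x))
  scottContinuous := scottContinuous_section ξ U (pairLeft E) fun y =>
    ScottHom.scottContinuous (pairRight D y)

/-- The map `y ↦ ∫ χ_U (x, y) dν(x)`. -/
noncomputable def integralLeft {D E : DCPO.{u}} (ν : V D)
    (U : Opens (WithScott (D ⊗ E : DCPO.{u}))) : ScottHom E unitInterval where
  toFun y := integral ν ((indicator U).comp (pairRight D y))
  scottContinuous := scottContinuous_section ν U (pairRight D) fun x =>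
    ScottHom.scottContinuous (pairLeft E x)

end DCPO

/-! ### Commutative strong monads -/

universe v w

/-- A Kleisli triple (monad in Manes' form) with object part `T`. -/
structure KleisliTriple {C : Type w} [Category.{v} C] (T : C → C) where
  unit (X : C) : X ⟶ T X
  ext {X Y : C} (f : X ⟶ T Y) : T X ⟶ T Y
  ext_unit (X : C) : ext (unit X) = 𝟙 (T X)
  unit_ext {X Y : C} (f : X ⟶ T Y) : unit X ≫ ext f = f
  ext_ext {X Y Z : C} (f : X ⟶ T Y) (g : Y ⟶ T Z) : ext f ≫ ext g = ext (f ≫ ext g)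

/-- The monad of a Kleisli triple. -/
def KleisliTriple.toMonad {C : Type w} [Category.{v} C] {T : C → C} (K : KleisliTriple T) :
    Monad C where
  obj := T
  map {_ Y} f := K.ext (f ≫ K.unit Y)
  map_id X := by simp [K.ext_unit]
  map_comp f g := by simp [K.ext_ext, K.unit_ext]
  η := { app := K.unit, naturality := by intros; simp [K.unit_ext] }
  μ := { app := fun X => K.ext (𝟙 (T X)), naturality := by intros; simp [K.ext_ext, K.unit_ext] }
  assoc X := by simp [K.ext_ext, K.unit_ext]
  left_unit X := by simp [K.unit_ext]
  right_unit X := by simp [K.ext_ext, K.unit_ext, K.ext_unit]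

/-- A (left) strength for a monad on a monoidal category. -/
structure MonadStrength {C : Type w} [Category.{v} C] [MonoidalCategory C] (T : Monad C) where
  app (X Y : C) : X ⊗ T.obj Y ⟶ T.obj (X ⊗ Y)
  naturality {X X' Y Y' : C} (f : X ⟶ X') (g : Y ⟶ Y') :
    (f ⊗ₘ T.map g) ≫ app X' Y' = app X Y ≫ T.map (f ⊗ₘ g)
  leftUnitor (X : C) : app (𝟙_ C) X ≫ T.map (λ_ X).hom = (λ_ (T.obj X)).hom
  associator (X Y Z : C) : app (X ⊗ Y) Z ≫ T.map (α_ X Y Z).hom =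
    (α_ X Y (T.obj Z)).hom ≫ (X ◁ app Y Z) ≫ app X (Y ⊗ Z)
  unit (X Y : C) : (X ◁ T.η.app Y) ≫ app X Y = T.η.app (X ⊗ Y)
  mul (X Y : C) : (X ◁ T.μ.app Y) ≫ app X Y =
    app X (T.obj Y) ≫ T.map (app X Y) ≫ T.μ.app (X ⊗ Y)

namespace MonadStrength

variable {C : Type w} [Category.{v} C] [MonoidalCategory C] [BraidedCategory C] {T : Monad C}

/-- The right strength obtained from a left strength by means of the braiding. -/
def right (τ : MonadStrength T) (X Y : C) : T.obj X ⊗ Y ⟶ T.obj (X ⊗ Y) :=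
  (β_ (T.obj X) Y).hom ≫ τ.app Y X ≫ T.map (β_ Y X).hom

/-- A strong monad is commutative if the two ways of combining the left and the right strength
into a map `T X ⊗ T Y ⟶ T (X ⊗ Y)` agree. -/
def IsCommutative (τ : MonadStrength T) : Prop :=
  ∀ X Y : C,
    τ.right X (T.obj Y) ≫ T.map (τ.app X Y) ≫ T.μ.app (X ⊗ Y) =
      τ.app (T.obj X) Y ≫ T.map (τ.right X Y) ≫ T.μ.app (X ⊗ Y)

end MonadStrength

open Filter

/-! ### Scott-continuous maps into the unit interval -/

/-! `M D` is the least sub-dcpo containing the simple valuations, so a property closed under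
directed suprema holds throughout `M D` once it holds for simple valuations. In particular, two
Scott-continuous maps out of `M D` that agree on simple valuations are equal. Against a simple
valuation an integral is a finite sum, so the identities reduce to manipulations of finite sums.

For this the integral must be Scott-continuous in the valuation and in the integrand. The Choquet
formula reduces both to a limit theorem for nets of antitone functions on `[0,1]`
(`tendsto_integral_of_antitone`).

The Kleisli extension lands in `M E` because it sends a simple valuation to a combination of values
of `f`, `M E` is closed under such combinations (`combo_mem_dClosureSimple`), and directed suprema
are preserved (`exists_bind`). The interchange of integrals is the swap of a finite double sum,
extended in each valuation in turn (`integral_integralRight`). With the first argument fixed, the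
strength is `M` applied to `y ↦ (x, y)`; its laws are then formal, and commutativity is the
interchange. -/

theorem ScottContinuous.tendsto_coe {P : Type*} [PartialOrder P] {g : P → unitInterval}
    (hg : ScottContinuous g) {s : Set P} (hs : s.Nonempty) (hd : DirectedOn (· ≤ ·) s) {a : P}
    (ha : IsLUB s a) : Tendsto (fun x : s => (g x : ℝ)) atTop (𝓝 (g a : ℝ)) := by
  refine (continuous_subtype_val.tendsto _).comp
    (tendsto_atTop_isLUB (f := fun x : s => g x) (fun x y h => hg.monotone h) ?_)
  have := hg hs hd ha
  rwa [Set.image_eq_range] at this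

theorem isDirectedOrder_of_directedOn {P : Type*} [PartialOrder P] {s : Set P}
    (hd : DirectedOn (· ≤ ·) s) : IsDirectedOrder s :=
  ⟨fun a b => by
    obtain ⟨c, hc, h₁, h₂⟩ := hd a a.2 b b.2
    exact ⟨⟨c, hc⟩, h₁, h₂⟩⟩

/-- The limit of a convergent monotone net is its supremum. Scott-continuity into the unit interval
can thus be proved with limits, which respect sums, multiples and integrals. -/
theorem scottContinuous_of_tendsto_coe {P : Type*} [PartialOrder P] {g : P → unitInterval}
    (hg : Monotone g)
    (h : ∀ (s : Set P) (_ : s.Nonempty) (_ : DirectedOn (· ≤ ·) s) (a : P) (_ : IsLUB s a),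
      Tendsto (fun x : s => (g x : ℝ)) atTop (𝓝 (g a : ℝ))) : ScottContinuous g := by
  intro s hs hd a ha
  have := hs.to_subtype
  have := isDirectedOrder_of_directedOn hd
  rw [Set.image_eq_range]
  exact isLUB_of_tendsto_atTop (f := fun x : s => g x) (fun x y hxy => hg hxy)
    (tendsto_subtype_rng.2 (h s hs hd a ha))

/-! ### Integrals of antitone functions -/

/-- The right Riemann sum is off by at most `1 / n`, whatever `φ` is; this uniformity replaces
dominated convergence, which is not valid for nets. -/
theorem Antitone.integral_zero_one_bounds {φ : ℝ → ℝ} (hφ : Antitone φ) (h₀ : ∀ t, 0 ≤ φ t)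
    (h₁ : ∀ t, φ t ≤ 1) {n : ℕ} (hn : n ≠ 0) :
    (∑ i ∈ Finset.range n, φ ((i + 1 : ℕ) / n)) / n ≤ ∫ t in (0 : ℝ)..1, φ t ∧
      ∫ t in (0 : ℝ)..1, φ t ≤ (∑ i ∈ Finset.range n, φ ((i + 1 : ℕ) / n)) / n + 1 / n := by
  have hn' : (0 : ℝ) < n := by positivity
  have hψ : Antitone fun x : ℝ => φ (x / n) := fun x y h => hφ (by gcongr)
  have hI : ∫ x in (0 : ℝ)..n, φ (x / n) = n * ∫ t in (0 : ℝ)..1, φ t := by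
    rw [intervalIntegral.integral_comp_div (fun x => φ x) hn'.ne']
    simp [hn'.ne']
  have hl := (hψ.antitoneOn (Set.Icc (0 : ℝ) (0 + n))).sum_le_integral
  have hu := (hψ.antitoneOn (Set.Icc (0 : ℝ) (0 + n))).integral_le_sum
  simp only [zero_add] at hl hu
  rw [hI] at hl hu
  -- The left and right Riemann sums telescope to a difference of `φ 0 - φ 1 ≤ 1`.
  have hs : ∑ i ∈ Finset.range n, φ (i / n) ≤
      ∑ i ∈ Finset.range n, φ ((i + 1 : ℕ) / n) + 1 := by
    have := Finset.sum_range_succ' (fun i : ℕ => φ (i / n)) n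
    rw [Finset.sum_range_succ] at this
    linarith [h₀ ((n : ℝ) / n), h₁ ((0 : ℕ) / (n : ℝ))]
  rw [← add_div, div_le_iff₀' hn', le_div_iff₀' hn']
  exact ⟨hl, hu.trans hs⟩

/-- Pointwise convergence of bounded antitone functions, along any filter, implies convergence of
the integrals. -/
theorem tendsto_integral_of_antitone {ι : Type*} {l : Filter ι} {φ : ι → ℝ → ℝ} {ψ : ℝ → ℝ}
    (hφ : ∀ i, Antitone (φ i)) (h₀ : ∀ i t, 0 ≤ φ i t) (h₁ : ∀ i t, φ i t ≤ 1)
    (hψ : Antitone ψ) (h₀' : ∀ t, 0 ≤ ψ t) (h₁' : ∀ t, ψ t ≤ 1)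
    (h : ∀ t, Tendsto (fun i => φ i t) l (𝓝 (ψ t))) :
    Tendsto (fun i => ∫ t in (0 : ℝ)..1, φ i t) l (𝓝 (∫ t in (0 : ℝ)..1, ψ t)) := by
  rw [Metric.tendsto_nhds]
  intro ε hε
  -- One half of `ε` pays for the discretisation into `m + 1` pieces, the other for the convergence
  -- at these finitely many nodes.
  obtain ⟨m, hm⟩ := exists_nat_one_div_lt (half_pos hε)
  have hS : Tendsto (fun i => (∑ k ∈ Finset.range (m + 1), φ i ((k + 1 : ℕ) / (m + 1 : ℕ))) /
      (m + 1 : ℕ)) l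
      (𝓝 ((∑ k ∈ Finset.range (m + 1), ψ ((k + 1 : ℕ) / (m + 1 : ℕ))) / (m + 1 : ℕ))) :=
    (tendsto_finsetSum _ fun k _ => h _).div_const _
  filter_upwards [Metric.tendsto_nhds.1 hS _ (half_pos hε)] with i hi
  have b₁ := (hφ i).integral_zero_one_bounds (h₀ i) (h₁ i) m.succ_ne_zero
  have b₂ := hψ.integral_zero_one_bounds h₀' h₁' m.succ_ne_zero
  rw [Real.dist_eq, abs_lt] at hi ⊢
  push_cast at *
  constructor <;> linarith [b₁.1, b₁.2, b₂.1, b₂.2, hi.1, hi.2]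

namespace SubprobValuation

variable {X : Type*} [TopologicalSpace X]

/-! ### Pointwise criteria for suprema and Scott-continuity -/

theorem isLUB_of_eval {s : Set (SubprobValuation X)} {ν : SubprobValuation X}
    (h : ∀ U, IsLUB (eval U '' s) (ν U)) : IsLUB s ν :=
  ⟨fun ξ hξ U => (h U).1 ⟨ξ, hξ, rfl⟩,
    fun ξ hξ U => (h U).2 (by rintro _ ⟨ζ, hζ, rfl⟩; exact hξ hζ U)⟩

theorem scottContinuous_of_eval {P : Type*} [PartialOrder P] {g : P → SubprobValuation X}
    (h : ∀ U, ScottContinuous fun p => g p U) : ScottContinuous g := by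
  intro s hs hd a ha
  refine isLUB_of_eval fun U => ?_
  rw [Set.image_image]
  exact h U hs hd ha

theorem scottContinuous_eval {P : Type*} [PartialOrder P] {g : P → SubprobValuation X}
    (h : ScottContinuous g) (U : Opens X) : ScottContinuous fun p => g p U :=
  ScottContinuous.comp (g := fun ν : SubprobValuation X => ν U) h (eval U).scottContinuous

/-! ### Scott-continuity and linearity of the integral -/

theorem antitone_superlevel (ν : SubprobValuation X) (f : C(X, WithScott unitInterval)) :
    Antitone fun t => (ν (superlevel f t) : ℝ) := fun _ _ hst =>
  ν.scottContinuous.monotone fun _ hx => lt_of_le_of_lt hst hx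

theorem coe_integral (ν : SubprobValuation X) (f : C(X, WithScott unitInterval)) :
    (integral ν f : ℝ) = ∫ t in (0 : ℝ)..1, (ν (superlevel f t) : ℝ) := rfl

theorem integral_mono (ν : SubprobValuation X) {ξ : SubprobValuation X} (h : ν ≤ ξ)
    {f g : C(X, WithScott unitInterval)}
    (hfg : ∀ x, WithScott.ofScott (f x) ≤ WithScott.ofScott (g x)) :
    integral ν f ≤ integral ξ g :=
  Subtype.coe_le_coe.1 <| intervalIntegral.integral_mono_on zero_le_one
    (antitone_superlevel ν f).intervalIntegrable (antitone_superlevel ξ g).intervalIntegrable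
    fun t _ => (h _).trans (ξ.scottContinuous.monotone fun x hx =>
      lt_of_lt_of_le (show t < _ from hx) (hfg x))

theorem scottContinuous_integral_left (f : C(X, WithScott unitInterval)) :
    ScottContinuous fun ν : SubprobValuation X => integral ν f :=
  scottContinuous_of_tendsto_coe (fun ν _ h => integral_mono ν h fun _ => le_rfl)
    fun _ hs hd a ha => tendsto_integral_of_antitone
      (fun ν => antitone_superlevel ν.1 f) (fun ν _ => (ν.1 _).2.1) (fun ν _ => (ν.1 _).2.2)
      (antitone_superlevel a f) (fun _ => (a _).2.1) (fun _ => (a _).2.2)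
      fun _ => (scottContinuous_eval ScottContinuous.id _).tendsto_coe hs hd ha

/-- The inequality `t < f` is strict: if every `f p x` were at most `t`, so would be their limit. -/
theorem scottContinuous_superlevel {P : Type*} [PartialOrder P]
    {f : P → C(X, WithScott unitInterval)}
    (hf : ∀ x, ScottContinuous fun p => WithScott.ofScott (f p x)) (t : ℝ) :
    ScottContinuous fun p => superlevel (f p) t := by
  intro s hs hd a ha
  refine ⟨?_, fun W hW x (hx : t < _) => ?_⟩
  · rintro _ ⟨p, hp, rfl⟩ x (hx : t < _)
    exact lt_of_lt_of_le hx ((hf x).monotone (ha.1 hp))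
  · have := hs.to_subtype
    have := isDirectedOrder_of_directedOn hd
    by_contra hxW
    have hle : ∀ p ∈ s, ((WithScott.ofScott (f p x) : unitInterval) : ℝ) ≤ t := fun p hp =>
      not_lt.1 fun h => hxW (hW ⟨p, hp, rfl⟩ h)
    exact not_le.2 hx (le_of_tendsto' ((hf x).tendsto_coe hs hd ha) fun p => hle p p.2)

theorem scottContinuous_integral_right (ν : SubprobValuation X) {P : Type*} [PartialOrder P]
    {f : P → C(X, WithScott unitInterval)}
    (hf : ∀ x, ScottContinuous fun p => WithScott.ofScott (f p x)) :
    ScottContinuous fun p => integral ν (f p) :=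
  scottContinuous_of_tendsto_coe
    (fun _ _ h => integral_mono ν le_rfl fun x => (hf x).monotone h)
    fun _ hs hd a ha => tendsto_integral_of_antitone
      (fun p => antitone_superlevel ν (f p)) (fun _ _ => (ν _).2.1) (fun _ _ => (ν _).2.2)
      (antitone_superlevel ν (f a)) (fun _ => (ν _).2.1) (fun _ => (ν _).2.2)
      fun t => (ScottContinuous.comp (scottContinuous_superlevel hf t)
        ν.scottContinuous).tendsto_coe hs hd ha

theorem integral_eq_sum {ι : Type*} [Fintype ι] {ν : SubprobValuation X} {r : ι → ℝ}
    {ξ : ι → SubprobValuation X} (h : ∀ U, (ν U : ℝ) = ∑ i, r i * (ξ i U : ℝ))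
    (f : C(X, WithScott unitInterval)) :
    (integral ν f : ℝ) = ∑ i, r i * (integral (ξ i) f : ℝ) := by
  simp only [coe_integral, h]
  rw [intervalIntegral.integral_finsetSum fun i _ =>
    (antitone_superlevel (ξ i) f).intervalIntegrable.const_mul _]
  simp

/-- As a function of `t`, the mass of the superlevel set is the indicator of `t < f x`, and `f x`
lies in `[0,1]`. -/
theorem integral_dirac (x : X) (f : C(X, WithScott unitInterval)) :
    integral (dirac x) f = WithScott.ofScott (f x) := by
  apply Subtype.ext
  set a : unitInterval := WithScott.ofScott (f x) with ha
  have h : ∀ t : ℝ, ((dirac x (superlevel f t) : unitInterval) : ℝ) =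
      (Set.Iio (a : ℝ)).indicator (fun _ => (1 : ℝ)) t := by
    intro t
    by_cases hx : x ∈ superlevel f t
    · have : (dirac x) (superlevel f t) = 1 := if_pos hx
      rw [this, Set.indicator_of_mem (show t ∈ Set.Iio (a : ℝ) from hx)]
      rfl
    · have : (dirac x) (superlevel f t) = 0 := if_neg hx
      rw [this, Set.indicator_of_notMem (show t ∉ Set.Iio (a : ℝ) from hx)]
      rfl
  rw [coe_integral, intervalIntegral.integral_of_le zero_le_one,
    MeasureTheory.integral_Ioc_eq_integral_Ioo]
  simp only [h]
  rw [MeasureTheory.integral_indicator measurableSet_Iio, MeasureTheory.Measure.restrict_restrict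
    measurableSet_Iio, Set.Iio_inter_Ioo, min_eq_left a.2.2]
  simp [a.2.1]

/-! ### Convex combinations and the d-closure of the simple valuations -/

/-- The combination of valuations with nonnegative coefficients of sum at most one. -/
noncomputable def combo {ι : Type*} [Fintype ι] (r : ι → ℝ) (h₀ : ∀ i, 0 ≤ r i)
    (h₁ : ∑ i, r i ≤ 1) (ξ : ι → SubprobValuation X) : SubprobValuation X where
  toFun U := ⟨∑ i, r i * (ξ i U : ℝ), Finset.sum_nonneg fun i _ => mul_nonneg (h₀ i) (ξ i U).2.1,
    (Finset.sum_le_sum fun i _ => mul_le_of_le_one_right (h₀ i) (ξ i U).2.2).trans h₁⟩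
  scottContinuous := scottContinuous_of_tendsto_coe
    (fun U V h => Subtype.coe_le_coe.1 <| Finset.sum_le_sum fun i _ =>
      mul_le_mul_of_nonneg_left ((ξ i).scottContinuous.monotone h) (h₀ i))
    fun _ hs hd _ ha => tendsto_finsetSum _ fun i _ =>
      ((ξ i).scottContinuous.tendsto_coe hs hd ha).const_mul _
  strict := by
    have : ∀ i, (ξ i) ⊥ = 0 := fun i => (ξ i).strict
    simp [this]
  modular U V := by
    simp only [← Finset.sum_add_distrib, ← mul_add]
    exact Finset.sum_congr rfl fun i _ => congrArg _ ((ξ i).modular U V)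

section combo

variable {ι : Type*} [Fintype ι] {r : ι → ℝ} {h₀ : ∀ i, 0 ≤ r i} {h₁ : ∑ i, r i ≤ 1}

theorem coe_combo (ξ : ι → SubprobValuation X) (U : Opens X) :
    (combo r h₀ h₁ ξ U : ℝ) = ∑ i, r i * (ξ i U : ℝ) := rfl

theorem scottContinuous_combo {P : Type*} [PartialOrder P] {ξ : P → ι → SubprobValuation X}
    (hξ : ∀ i, ScottContinuous fun p => ξ p i) :
    ScottContinuous fun p => combo r h₀ h₁ (ξ p) :=
  scottContinuous_of_eval fun U => scottContinuous_of_tendsto_coe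
    (fun _ _ h => Subtype.coe_le_coe.1 <| Finset.sum_le_sum fun i _ =>
      mul_le_mul_of_nonneg_left ((hξ i).monotone h U) (h₀ i))
    fun _ hs hd _ ha => tendsto_finsetSum _ fun i _ =>
      ((scottContinuous_eval (hξ i) U).tendsto_coe hs hd ha).const_mul _

end combo

/-- Zero coefficients are discarded and the remaining indices are enumerated by some `Fin n`, as
`simple` requires. -/
theorem mem_simple_of_eq_sum {ι : Type*} [Fintype ι] {ν : SubprobValuation X} {r : ι → ℝ}
    {x : ι → X} (h₀ : ∀ i, 0 ≤ r i) (h₁ : ∑ i, r i ≤ 1)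
    (h : ∀ U, (ν U : ℝ) = ∑ i, r i * (dirac (x i) U : ℝ)) : ν ∈ simple X := by
  classical
  let e := Fintype.equivFin {i // r i ≠ 0}
  have key : ∀ g : ι → ℝ, ∑ k, r (e.symm k) * g (e.symm k) = ∑ i, r i * g i := by
    intro g
    rw [e.symm.sum_comp (fun i : {i // r i ≠ 0} => r i * g i),
      ← Fintype.sum_subtype_add_sum_subtype (fun i => r i ≠ 0) fun i => r i * g i, left_eq_add]
    exact Finset.sum_eq_zero fun i _ => by rw [not_not.1 i.2, zero_mul]
  refine ⟨_, fun k => r (e.symm k), fun k => x (e.symm k),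
    fun k => (h₀ _).lt_of_ne' (e.symm k).2, ?_, fun U => ?_⟩
  · simpa using (key fun _ => 1).trans_le (by simpa using h₁)
  · rw [h, key fun i => (dirac (x i) U : ℝ)]

theorem simple_subset : simple X ⊆ dClosureSimple X := fun _ h _ hB => hB.2 h

theorem dirac_mem_simple (x : X) : dirac x ∈ simple X :=
  mem_simple_of_eq_sum (ι := Unit) (r := fun _ => 1) (x := fun _ => x) (by simp) (by simp) (by simp)

/-- Induction for the d-closure of the simple valuations. -/
theorem dClosureSimple_induction {p : SubprobValuation X → Prop} (hp : DirSupClosed {ν | p ν})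
    (hs : ∀ ν ∈ simple X, p ν) {ν : SubprobValuation X} (hν : ν ∈ dClosureSimple X) : p ν :=
  hν _ ⟨hp, hs⟩

theorem _root_.DirSupClosed.preimage_scottContinuous {P Q : Type*} [PartialOrder P]
    [PartialOrder Q] {s : Set Q} (hs : DirSupClosed s) {g : P → Q} (hg : ScottContinuous g) :
    DirSupClosed (g ⁻¹' s) := fun _ hd h₀ h₁ _ ha =>
  hs (Set.image_subset_iff.2 hd) (h₀.image g) (h₁.mono_comp hg.monotone) (hg h₀ h₁ ha)

/-- Both maps send a directed set in the locus to the same image, whose supremum is unique. -/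
theorem dirSupClosed_eqLocus {P Q : Type*} [PartialOrder P] [PartialOrder Q] {f g : P → Q}
    (hf : ScottContinuous f) (hg : ScottContinuous g) : DirSupClosed {p | f p = g p} :=
  fun s hs h₀ h₁ a ha => by
    refine (hf h₀ h₁ ha).unique ?_
    rw [Set.image_congr hs]
    exact hg h₀ h₁ ha

/-- The valuations are released from being simple one index at a time, since closure under suprema
applies to one argument at a time. -/
theorem combo_mem_dClosureSimple {ι : Type*} [Fintype ι] {r : ι → ℝ} (h₀ : ∀ i, 0 ≤ r i)
    (h₁ : ∑ i, r i ≤ 1) {ξ : ι → SubprobValuation X} (hξ : ∀ i, ξ i ∈ dClosureSimple X) :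
    combo r h₀ h₁ ξ ∈ dClosureSimple X := by
  classical
  suffices H : ∀ (s : Finset ι) (ξ : ι → SubprobValuation X),
      (∀ i ∈ s, ξ i ∈ dClosureSimple X) → (∀ i ∉ s, ξ i ∈ simple X) →
        combo r h₀ h₁ ξ ∈ dClosureSimple X from
    H Finset.univ ξ (fun i _ => hξ i) (by simp)
  intro s
  induction s using Finset.induction_on with
  | empty =>
    -- A combination of simple valuations is simple: the coefficients multiply over the sigma type
    -- of indices.
    intro ξ _ hs
    choose n c x hc₀ hc₁ hξ using fun i => hs i (Finset.notMem_empty i)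
    refine simple_subset (mem_simple_of_eq_sum (ι := Σ i, Fin (n i))
      (r := fun k => r k.1 * c k.1 k.2) (x := fun k => x k.1 k.2)
      (fun k => mul_nonneg (h₀ _) (hc₀ _ _).le) ?_ fun U => ?_)
    · rw [Fintype.sum_sigma]
      simp only [← Finset.mul_sum]
      exact (Finset.sum_le_sum fun i _ => mul_le_of_le_one_right (h₀ i) (hc₁ i)).trans h₁
    · rw [Fintype.sum_sigma, coe_combo]
      simp only [hξ, Finset.mul_sum, mul_assoc]
  | insert j s hj ih =>
    intro ξ hξ hs
    have hup : ∀ i, ScottContinuous fun ζ => Function.update ξ j ζ i := by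
      intro i
      by_cases h : i = j
      · subst h; simp
      · simp [Function.update_of_ne h]
    -- Only the `j`-th valuation varies; the induction hypothesis covers the case where it is
    -- simple.
    have := dClosureSimple_induction (p := fun ζ =>
        combo r h₀ h₁ (Function.update ξ j ζ) ∈ dClosureSimple X)
      (dirSupClosed_dClosureSimple.preimage_scottContinuous (scottContinuous_combo hup))
      (fun ζ hζ => ih _ (fun i hi => ?_) fun i hi => ?_) (hξ j (Finset.mem_insert_self j s))
    · simpa using this
    · rw [Function.update_of_ne (ne_of_mem_of_not_mem hi hj)]
      exact hξ i (Finset.mem_insert_of_mem hi)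
    · by_cases h : i = j
      · subst h; simpa using hζ
      · rw [Function.update_of_ne h]
        exact hs i (by simp [h, hi])

/-- The order on the subtype is induced, so a supremum among all valuations that lies in the
d-closure is also a supremum there. -/
theorem scottContinuous_dClosureSimple_iff {P : Type*} [PartialOrder P]
    {g : P → dClosureSimple X} :
    ScottContinuous g ↔ ScottContinuous fun p => (g p : SubprobValuation X) := by
  refine ⟨fun h => ScottContinuous.comp h (inclusion X).scottContinuous, fun h s hs hd a ha => ?_⟩
  have := h hs hd ha
  refine ⟨?_, fun b hb => this.2 ?_⟩
  · rintro _ ⟨p, hp, rfl⟩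
    exact this.1 ⟨p, hp, rfl⟩
  · rintro _ ⟨p, hp, rfl⟩
    exact hb ⟨p, hp, rfl⟩

/-! ### Kleisli extension and the monad laws -/

section bind

variable {Y : Type*} [TopologicalSpace Y]

theorem integral_of_eq_sum_dirac {ι : Type*} [Fintype ι] {ν : SubprobValuation X} {r : ι → ℝ}
    {x : ι → X} (h : ∀ U, (ν U : ℝ) = ∑ i, r i * (dirac (x i) U : ℝ))
    (f : C(X, WithScott unitInterval)) :
    (integral ν f : ℝ) = ∑ i, r i * ((WithScott.ofScott (f (x i)) : unitInterval) : ℝ) := by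
  simp only [integral_eq_sum h f, integral_dirac]

/-- Scott-continuous maps on the d-closure of the simple valuations are determined by their values
at simple valuations. -/
theorem eq_of_eqOn_simple {Q : Type*} [PartialOrder Q] {f g : dClosureSimple X → Q}
    (hf : ScottContinuous f) (hg : ScottContinuous g)
    (h : ∀ ν (hν : ν ∈ simple X), f ⟨ν, simple_subset hν⟩ = g ⟨ν, simple_subset hν⟩) : f = g := by
  funext ⟨ν, hν⟩
  -- Membership is carried along in the predicate because `f` and `g` are defined only on the
  -- d-closure.
  suffices H : ∃ hν : ν ∈ dClosureSimple X, f ⟨ν, hν⟩ = g ⟨ν, hν⟩ from H.2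
  refine dClosureSimple_induction (p := fun ν => ∃ hν : ν ∈ dClosureSimple X, f ⟨ν, hν⟩ = g ⟨ν, hν⟩)
    (fun s hs h₀ hd a ha => ?_) (fun ν hν => ⟨simple_subset hν, h ν hν⟩) hν
  have ham : a ∈ dClosureSimple X :=
    dirSupClosed_dClosureSimple (fun x hx => (hs hx).1) h₀ hd ha
  refine ⟨ham, dirSupClosed_eqLocus hf hg (d := Subtype.val ⁻¹' s) (fun x hx => (hs hx).2) ?_ ?_ ?_⟩
  · obtain ⟨x, hx⟩ := h₀
    exact ⟨⟨x, (hs hx).1⟩, hx⟩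
  · intro x hx y hy
    obtain ⟨z, hz, h₁, h₂⟩ := hd _ hx _ hy
    exact ⟨⟨z, (hs hz).1⟩, hz, h₁, h₂⟩
  · exact ⟨fun x hx => ha.1 hx, fun b hb => ha.2 fun x hx => hb (a := ⟨x, (hs hx).1⟩) hx⟩

variable {D : Type*} [PartialOrder D]

/-- The function `x ↦ F x U`, for a Scott-continuous family `F` of valuations. -/
def evalComp (F : ScottHom D (dClosureSimple Y)) (U : Opens Y) :
    C(WithScott D, WithScott unitInterval) :=
  ((eval U).comp ((inclusion Y).comp F)).toContinuousMap

theorem evalComp_apply (F : ScottHom D (dClosureSimple Y)) (U : Opens Y) (x : WithScott D) :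
    WithScott.ofScott (evalComp F U x) = (F (WithScott.ofScott x)).1 U := rfl

/-- The valuations whose integral functional is represented in the d-closure form a sub-dcpo
containing the simple ones. Modularity of the functional thus needs no separate argument. -/
theorem exists_bind (F : ScottHom D (dClosureSimple Y)) {ν : SubprobValuation (WithScott D)}
    (hν : ν ∈ dClosureSimple (WithScott D)) :
    ∃ ξ ∈ dClosureSimple Y, ∀ U, ξ U = integral ν (evalComp F U) := by
  refine dClosureSimple_induction (p := fun ν => ∃ ξ ∈ dClosureSimple Y, ∀ U,
    ξ U = integral ν (evalComp F U)) (fun s hs h₀ hd a ha => ?_) (fun ν hν => ?_) hν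
  -- An inhabitant serves as the value of the choice function `g` outside `s`.
  · have : Nonempty (SubprobValuation Y) := ⟨(hs h₀.some_mem).choose⟩
    choose! g hgM hg using fun ν (h : ν ∈ s) => hs h
    have hmono : ∀ ν ∈ s, ∀ ξ ∈ s, ν ≤ ξ → g ν ≤ g ξ := fun ν hν ξ hξ h U => by
      rw [hg ν hν, hg ξ hξ]
      exact integral_mono ν h fun _ => le_rfl
    have hgd : DirectedOn (· ≤ ·) (g '' s) := by
      rintro _ ⟨ν, hν, rfl⟩ _ ⟨ξ, hξ, rfl⟩
      obtain ⟨ζ, hζ, h₁, h₂⟩ := hd ν hν ξ hξ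
      exact ⟨g ζ, ⟨ζ, hζ, rfl⟩, hmono _ hν _ hζ h₁, hmono _ hξ _ hζ h₂⟩
    have hlub := isLUB_dirSup (g '' s) (h₀.image g) hgd
    refine ⟨_, dirSupClosed_dClosureSimple (Set.image_subset_iff.2 fun ν hν => hgM ν hν)
      (h₀.image g) hgd hlub, fun U => ?_⟩
    refine ((eval U).scottContinuous (h₀.image g) hgd hlub).unique ?_
    rw [Set.image_image, Set.image_congr (f := fun ν => (eval U).toFun (g ν))
      (g := fun ν => integral ν (evalComp F U))
      fun ν hν => hg ν hν U]
    exact scottContinuous_integral_left _ h₀ hd ha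
  · obtain ⟨n, r, x, h₀, h₁, h⟩ := hν
    refine ⟨combo r (fun i => (h₀ i).le) h₁ fun i => (F (WithScott.ofScott (x i))).1,
      combo_mem_dClosureSimple _ _ fun i => (F (WithScott.ofScott (x i))).2,
      fun U => Subtype.ext ?_⟩
    rw [coe_combo, integral_of_eq_sum_dirac h]
    rfl

/-- The Kleisli extension of a Scott-continuous map. -/
noncomputable def bind (F : ScottHom D (dClosureSimple Y)) :
    ScottHom (dClosureSimple (WithScott D)) (dClosureSimple Y) where
  toFun ν := ⟨(exists_bind F ν.2).choose, (exists_bind F ν.2).choose_spec.1⟩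
  scottContinuous := by
    refine scottContinuous_dClosureSimple_iff.2 (scottContinuous_of_eval fun U => ?_)
    simp only [fun ν : dClosureSimple (WithScott D) => (exists_bind F ν.2).choose_spec.2 U]
    exact ScottContinuous.comp (inclusion _).scottContinuous (scottContinuous_integral_left _)

theorem bind_apply (F : ScottHom D (dClosureSimple Y)) (ν : dClosureSimple (WithScott D))
    (U : Opens Y) : (bind F ν).1 U = integral ν.1 (evalComp F U) :=
  (exists_bind F ν.2).choose_spec.2 U

/-- The map `x ↦ δ_x`. -/
noncomputable def diracHom (D : Type*) [PartialOrder D] [IsDcpo D] :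
    ScottHom D (dClosureSimple (WithScott D)) where
  toFun x := ⟨dirac (WithScott.toScott x), simple_subset (dirac_mem_simple _)⟩
  scottContinuous := by
    refine scottContinuous_dClosureSimple_iff.2 (scottContinuous_of_eval fun U => ?_)
    exact (DCPO.indicator (D := ⟨D⟩) U).scottContinuous

theorem bind_dirac [IsDcpo D] (F : ScottHom D (dClosureSimple Y)) (x : D) : bind F (diracHom D x) = F x :=
  Subtype.ext <| DFunLike.ext _ _ fun U => by
    rw [bind_apply]
    exact integral_dirac _ _

theorem bind_diracHom [IsDcpo D] (ν : dClosureSimple (WithScott D)) : bind (diracHom D) ν = ν := by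
  refine congrFun (eq_of_eqOn_simple (bind (diracHom D)).scottContinuous ScottContinuous.id ?_) ν
  rintro ν hν
  refine Subtype.ext <| DFunLike.ext _ _ fun U => Subtype.ext ?_
  obtain ⟨n, r, x, h₀, h₁, h⟩ := id hν
  refine (congrArg Subtype.val (bind_apply _ _ _)).trans ?_
  rw [integral_of_eq_sum_dirac h]
  exact (h U).symm

/-- For simple `ν` both sides are the combination of the valuations `bind G (F (x i))` with
coefficients `r i`. -/
theorem bind_bind {E : Type*} [PartialOrder E] (F : ScottHom D (dClosureSimple (WithScott E)))
    (G : ScottHom E (dClosureSimple Y)) (ν : dClosureSimple (WithScott D)) :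
    bind G (bind F ν) = bind ((bind G).comp F) ν := by
  refine congrFun (eq_of_eqOn_simple ((bind G).comp (bind F)).scottContinuous
    (bind ((bind G).comp F)).scottContinuous ?_) ν
  rintro ν hν
  refine Subtype.ext <| DFunLike.ext _ _ fun U => Subtype.ext ?_
  obtain ⟨n, r, x, h₀, h₁, h⟩ := id hν
  -- The valuations `F (x i)` need not be simple, so linearity of the integral in the valuation is
  -- used for the outer extension.
  have key : ∀ W, ((bind F ⟨ν, simple_subset hν⟩).1 W : ℝ) =
      ∑ i, r i * ((F (WithScott.ofScott (x i))).1 W : ℝ) := fun W => by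
    rw [bind_apply, integral_of_eq_sum_dirac h]
    rfl
  refine (congrArg Subtype.val (bind_apply _ _ _)).trans
    (Eq.trans ?_ (congrArg Subtype.val (bind_apply _ _ _)).symm)
  rw [integral_of_eq_sum_dirac h, integral_eq_sum key]
  simp only [evalComp_apply]
  exact Finset.sum_congr rfl fun i _ =>
    congrArg _ (congrArg Subtype.val (bind_apply G (F (WithScott.ofScott (x i))) U).symm)

end bind

end SubprobValuation

/-! ### Interchange of integrals and the Kleisli triple -/

namespace DCPO
open SubprobValuation

/-- The integrals of the sections of an open set in a product can be interchanged. -/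
theorem integral_integralRight {D E : DCPO.{u}} {ν : V D} (hν : ν ∈ dClosureSimple (WithScott D))
    {ξ : V E} (hξ : ξ ∈ dClosureSimple (WithScott E)) (U : Opens (WithScott (D ⊗ E : DCPO.{u}))) :
    integral ν (integralRight ξ U) = integral ξ (integralLeft ν U) := by
  -- In `ν`, the left side varies through the valuation and the right side through the integrand;
  -- for `ξ` below, the roles are exchanged.
  refine dClosureSimple_induction (X := WithScott D)
    (p := fun ν => integral (D := D) ν (integralRight ξ U) = integral ξ (integralLeft ν U))
    (dirSupClosed_eqLocus (scottContinuous_integral_left _)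
      (scottContinuous_integral_right _ fun y => scottContinuous_integral_left _)) ?_ hν
  intro ν hν
  refine dClosureSimple_induction (X := WithScott E)
    (p := fun ξ => integral (D := D) ν (integralRight ξ U) = integral ξ (integralLeft ν U))
    (dirSupClosed_eqLocus (scottContinuous_integral_right _ fun y =>
      scottContinuous_integral_left _) (scottContinuous_integral_left _)) ?_ hξ
  intro ξ hξ
  obtain ⟨n, r, x, -, -, hν⟩ := hν
  obtain ⟨m, s, y, -, -, hξ⟩ := hξ
  refine Subtype.ext ((integral_of_eq_sum_dirac hν _).trans
    (Eq.trans ?_ (integral_of_eq_sum_dirac hξ _).symm))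
  have hR : ∀ i, ((WithScott.ofScott ((integralRight (D := D) ξ U).toContinuousMap (x i)) :
      unitInterval) : ℝ) = _ := fun i => integral_of_eq_sum_dirac hξ _
  have hL : ∀ j, ((WithScott.ofScott ((integralLeft (E := E) ν U).toContinuousMap (y j)) :
      unitInterval) : ℝ) = _ := fun j => integral_of_eq_sum_dirac hν _
  simp only [hR, hL, Finset.mul_sum]
  rw [Finset.sum_comm]
  exact Finset.sum_congr rfl fun j _ => Finset.sum_congr rfl fun i _ => mul_left_comm _ _ _

/-- The Kleisli triple of the monad `M`. -/
noncomputable def kleisliM : KleisliTriple DCPO.M.{u} where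
  unit D := diracHom D
  ext f := bind f
  ext_unit _ := ScottHom.ext bind_diracHom
  unit_ext f := hom_ext' (bind_dirac f)
  ext_ext f g := hom_ext' (bind_bind f g)

theorem kleisliM_ext_apply {D E : DCPO.{u}} (f : D ⟶ M E) (ν : M D) (U : Opens (WithScott E)) :
    eval U (incl E (kleisliM.ext f ν)) = kleisliExt (f ≫ incl E) (incl D ν) U :=
  by
  have h := bind_apply f ν U
  change (kleisliM.ext f ν).1 U = _
  exact h

/-! ### The strength -/

theorem hom_ext_pairLeft {D E F : DCPO.{u}} {f g : D ⊗ E ⟶ F}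
    (h : ∀ x, pairLeft E x ≫ f = pairLeft E x ≫ g) : f = g :=
  hom_ext' fun p => ConcreteCategory.congr_hom (h p.1) p.2

/-- For fixed `U` and `y`, the integrand `δ_(x,y) U` is Scott-continuous in `x`. -/
theorem scottContinuous_bind_pairLeft {D : DCPO.{u}} (E : DCPO.{u}) (ν : M E) :
    ScottContinuous fun x : D => kleisliM.ext (pairLeft E x ≫ kleisliM.unit (D ⊗ E)) ν := by
  refine scottContinuous_dClosureSimple_iff.2 <| scottContinuous_of_eval fun U => ?_
  have h : ∀ x : D, (kleisliM.ext (pairLeft E x ≫ kleisliM.unit (D ⊗ E)) ν).1 U =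
    _ := fun x => bind_apply (pairLeft E x ≫ kleisliM.unit (D ⊗ E)) ν U
  simp only [h]
  refine scottContinuous_integral_right _ fun y => ?_
  exact scottContinuous_eval (((SubprobValuation.inclusion _).comp
    (diracHom (D ⊗ E : DCPO.{u}))).comp (pairRight D (WithScott.ofScott y))).scottContinuous U

/-- The strength of the monad `M`, as a map. -/
noncomputable def strengthHom (D E : DCPO.{u}) : D ⊗ M E ⟶ M (D ⊗ E) :=
  (⟨fun p => kleisliM.ext (pairLeft E p.1 ≫ kleisliM.unit (D ⊗ E)) p.2,
    -- Separate Scott-continuity in the two arguments gives joint Scott-continuity.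
    ScottContinuous.fromProd
      (fun x => (kleisliM.ext (pairLeft E x ≫ kleisliM.unit (D ⊗ E))).scottContinuous)
      (scottContinuous_bind_pairLeft E)⟩ :
    ScottHom (D × M E) (M (D ⊗ E)))

theorem pairLeft_strengthHom {D : DCPO.{u}} (E : DCPO.{u}) (x : D) :
    pairLeft (M E) x ≫ strengthHom D E = kleisliM.ext (pairLeft E x ≫ kleisliM.unit (D ⊗ E)) := rfl

/-- The first factor is the functorial action on `f`, which an extension absorbs. With `x` fixed,
this rule does most of the work in the strength laws. -/
theorem _root_.KleisliTriple.ext_unit_comp_ext {C : Type w} [Category.{v} C] {T : C → C}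
    (K : KleisliTriple T) {X Y Z : C} (f : X ⟶ Y) (g : Y ⟶ T Z) :
    K.ext (f ≫ K.unit Y) ≫ K.ext g = K.ext (f ≫ g) := by
  rw [K.ext_ext, Category.assoc, K.unit_ext]

/-- The strength of the monad `M`. -/
noncomputable def strengthM : MonadStrength kleisliM.{u}.toMonad where
  app := strengthHom
  naturality {X X' Y Y'} f g := hom_ext_pairLeft fun x => by
    change kleisliM.ext (g ≫ kleisliM.unit Y') ≫
      kleisliM.ext (pairLeft Y' (f x) ≫ kleisliM.unit (X' ⊗ Y')) =
      kleisliM.ext (pairLeft Y x ≫ kleisliM.unit (X ⊗ Y)) ≫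
        kleisliM.ext ((f ⊗ₘ g) ≫ kleisliM.unit (X' ⊗ Y'))
    rw [KleisliTriple.ext_unit_comp_ext, KleisliTriple.ext_unit_comp_ext]
    rfl
  leftUnitor X := hom_ext_pairLeft fun x => by
    change kleisliM.ext (pairLeft X x ≫ kleisliM.unit (𝟙_ DCPO ⊗ X)) ≫
      kleisliM.ext ((λ_ X).hom ≫ kleisliM.unit X) = 𝟙 (M X)
    rw [KleisliTriple.ext_unit_comp_ext]
    exact kleisliM.ext_unit X
  associator X Y Z := hom_ext_pairLeft fun x => by
    change kleisliM.ext (pairLeft Z x ≫ kleisliM.unit ((X ⊗ Y) ⊗ Z)) ≫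
      kleisliM.ext ((α_ X Y Z).hom ≫ kleisliM.unit (X ⊗ Y ⊗ Z)) =
      kleisliM.ext (pairLeft Z x.2 ≫ kleisliM.unit (Y ⊗ Z)) ≫
        kleisliM.ext (pairLeft (Y ⊗ Z) x.1 ≫ kleisliM.unit (X ⊗ Y ⊗ Z))
    rw [KleisliTriple.ext_unit_comp_ext, KleisliTriple.ext_unit_comp_ext]
    rfl
  unit X Y := hom_ext_pairLeft fun x =>
    kleisliM.unit_ext (pairLeft Y x ≫ kleisliM.unit (X ⊗ Y))
  mul X Y := hom_ext_pairLeft fun x => by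
    -- Both sides are the extension of `M` applied to `y ↦ (x, y)`.
    change kleisliM.ext (𝟙 (M Y)) ≫ kleisliM.ext (pairLeft Y x ≫ kleisliM.unit (X ⊗ Y)) =
      kleisliM.ext (pairLeft (M Y) x ≫ kleisliM.unit (X ⊗ M Y)) ≫
        kleisliM.ext (strengthHom X Y ≫ kleisliM.unit (M (X ⊗ Y))) ≫ kleisliM.ext (𝟙 (M (X ⊗ Y)))
    rw [KleisliTriple.ext_unit_comp_ext, KleisliTriple.ext_unit_comp_ext, KleisliTriple.ext_ext,
      Category.id_comp, Category.comp_id, pairLeft_strengthHom]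

/-! ### The right strength and commutativity -/

/-- The right strength of the monad `M`, as a map. -/
noncomputable def rightStrengthHom (D E : DCPO.{u}) : M D ⊗ E ⟶ M (D ⊗ E) := strengthM.right D E

theorem rightStrengthHom_apply {D E : DCPO.{u}} (ν : M D) (y : E) :
    rightStrengthHom D E (ν, y) = kleisliM.ext (pairRight D y ≫ kleisliM.unit (D ⊗ E)) ν := by
  change (kleisliM.ext (pairLeft D y ≫ kleisliM.unit (E ⊗ D)) ≫
    kleisliM.ext ((β_ E D).hom ≫ kleisliM.unit (D ⊗ E))) ν = _
  rw [KleisliTriple.ext_unit_comp_ext]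
  rfl

/-- The integrand `δ_(x,y) U` is by definition `χ_U (x, y)`. -/
theorem eval_incl_strengthHom {D E : DCPO.{u}} (x : D) (ν : M E)
    (U : Opens (WithScott (D ⊗ E : DCPO.{u}))) :
    eval U (incl (D ⊗ E) (strengthHom D E (x, ν))) = strengthVal x (incl E ν) U :=
  kleisliM_ext_apply (pairLeft E x ≫ kleisliM.unit (D ⊗ E)) ν U

theorem eval_incl_rightStrengthHom {D E : DCPO.{u}} (ν : M D) (y : E)
    (U : Opens (WithScott (D ⊗ E : DCPO.{u}))) :
    eval U (incl (D ⊗ E) (rightStrengthHom D E (ν, y))) = integralLeft (incl D ν) U y := by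
  rw [rightStrengthHom_apply]
  exact kleisliM_ext_apply (pairRight D y ≫ kleisliM.unit (D ⊗ E)) ν U

/-- Evaluated at `U`, this is the interchange of the two iterated integrals of `χ_U`. -/
theorem ext_pairRight_strengthHom {D E : DCPO.{u}} (ν : M D) (ξ : M E) :
    kleisliM.ext (pairRight D ξ ≫ strengthHom D E) ν =
      kleisliM.ext (pairLeft E ν ≫ rightStrengthHom D E) ξ := by
  refine Subtype.ext <| DFunLike.ext _ _ fun U => ?_
  refine (kleisliM_ext_apply _ ν U).trans (Eq.trans ?_ (kleisliM_ext_apply _ ξ U).symm)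
  have hL : (eval U).comp ((pairRight D ξ ≫ strengthHom D E) ≫ incl (D ⊗ E)) =
      integralRight (incl E ξ) U := ScottHom.ext fun x => eval_incl_strengthHom x ξ U
  have hR : (eval U).comp ((pairLeft E ν ≫ rightStrengthHom D E) ≫ incl (D ⊗ E)) =
      integralLeft (incl D ν) U := ScottHom.ext fun y => eval_incl_rightStrengthHom ν y U
  unfold kleisliExt
  rw [hL, hR]
  exact integral_integralRight ν.2 ξ.2 U

/-- Fixing `ξ` collapses one side of the commutativity square to a single extension, integrating
over `ν` last. -/
theorem rightStrengthHom_comp_apply {D E : DCPO.{u}} (ν : M D) (ξ : M E) :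
    (rightStrengthHom D (M E) ≫ kleisliM.ext (strengthHom D E ≫ kleisliM.unit (M (D ⊗ E))) ≫
      kleisliM.ext (𝟙 (M (D ⊗ E)))) (ν, ξ) =
      kleisliM.ext (pairRight D ξ ≫ strengthHom D E) ν := by
  rw [KleisliTriple.ext_unit_comp_ext, Category.comp_id]
  change kleisliM.ext (strengthHom D E) (rightStrengthHom D (M E) (ν, ξ)) = _
  rw [rightStrengthHom_apply]
  change (kleisliM.ext (pairRight D ξ ≫ kleisliM.unit (D ⊗ M E)) ≫
    kleisliM.ext (strengthHom D E)) ν = _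
  rw [KleisliTriple.ext_unit_comp_ext]

theorem strengthHom_comp_apply {D E : DCPO.{u}} (ν : M D) (ξ : M E) :
    (strengthHom (M D) E ≫ kleisliM.ext (rightStrengthHom D E ≫ kleisliM.unit (M (D ⊗ E))) ≫
      kleisliM.ext (𝟙 (M (D ⊗ E)))) (ν, ξ) =
      kleisliM.ext (pairLeft E ν ≫ rightStrengthHom D E) ξ := by
  rw [KleisliTriple.ext_unit_comp_ext, Category.comp_id]
  change (kleisliM.ext (pairLeft E ν ≫ kleisliM.unit (M D ⊗ E)) ≫
    kleisliM.ext (rightStrengthHom D E)) ξ = _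
  rw [KleisliTriple.ext_unit_comp_ext]

theorem isCommutative_strengthM : strengthM.{u}.IsCommutative := fun D E =>
  hom_ext' fun p : (M D ⊗ M E : DCPO.{u}) => (rightStrengthHom_comp_apply p.1 p.2).trans <|
    (ext_pairRight_strengthHom p.1 p.2).trans (strengthHom_comp_apply p.1 p.2).symm

end DCPO

/-! ### The main theorem -/

theorem mainTheorem1 :
    ∃ (K : KleisliTriple DCPO.M.{u}) (τ : MonadStrength K.toMonad),
      τ.IsCommutative ∧
      (∀ (D : DCPO.{u}) (x : D),
        DCPO.incl D (K.unit D x) = SubprobValuation.dirac (WithScott.toScott x)) ∧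
      (∀ (D E : DCPO.{u}) (f : D ⟶ DCPO.M E) (ν : DCPO.M D) (U : Opens (WithScott E)),
        SubprobValuation.eval U (DCPO.incl E (K.ext f ν)) =
          DCPO.kleisliExt (f ≫ DCPO.incl E) (DCPO.incl D ν) U) ∧
      (∀ (D E : DCPO.{u}) (x : D) (ν : DCPO.M E) (U : Opens (WithScott (D ⊗ E : DCPO.{u}))),
        SubprobValuation.eval U (DCPO.incl (D ⊗ E) (τ.app D E (x, ν))) =
          DCPO.strengthVal x (DCPO.incl E ν) U) ∧
      (∀ (D E : DCPO.{u}) (ν : DCPO.M D) (ξ : DCPO.M E)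
          (U : Opens (WithScott (D ⊗ E : DCPO.{u}))),
        DCPO.integral (DCPO.incl D ν) (DCPO.integralRight (DCPO.incl E ξ) U) =
          DCPO.integral (DCPO.incl E ξ) (DCPO.integralLeft (DCPO.incl D ν) U)) :=
  ⟨DCPO.kleisliM, DCPO.strengthM, DCPO.isCommutative_strengthM, fun _ _ => rfl,
    fun _ _ => DCPO.kleisliM_ext_apply, fun _ _ => DCPO.eval_incl_strengthHom,
    fun _ _ ν ξ => DCPO.integral_integralRight ν.2 ξ.2⟩
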